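/- \textbf{Theorem (Christoffel coefficients positivity).} Let $p\geqslant 1$ and let $T=(T_{n,m})_{n,m\geqslant 0}$ be a real semi-infinite banded monic lower Hessenberg matrix: $T_{n,n+1}=1$, $T_{n,m}=0$ if $m>n+1$ or $m<n-p$, and $T_{n+p,n}\neq 0$ for all $n\geqslant 0$. Let $T^{[N]}=(T_{n,m})_{0\leqslant n,m\leqslant N}$, $N\geqslant 0$. \emph{Recursion polynomials.} Let $B_0=1$ and $B_{n+1}=xB_n-\sum_{j=0}^{n}T_{n,j}B_j$. Let $\nu=(\nu_{n,a})_{0\leqslant n\leqslant p-1,\,1\leqslant a\leqslant p}$ be a real lower unitriangular $p\times p$ matrix. For $a\in\{1,\dots,p\}$ let $A^{(a)}_n=\nu_{n,a}$ for $0\leqslant n\leqslant p-1$, and let the other $A^{(a)}_n$ be determined by $A^{(a)}_{n-1}+\sum_{i=0}^{p}T_{n+i,n}A^{(a)}_{n+i}=xA^{(a)}_n$, $n\geqslant 0$, with $A^{(a)}_{-1}=0$. Let $Q_{n,N}$ be the determinant of the $p\times p$ matrix with rows $\big(A^{(1)}_m,\dots,A^{(p)}_m\big)$, $m=n,N+1,\dots,N+p-1$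 (in this order). \emph{Christoffel coefficients.} If $\lambda^{[N]}_1,\dots,\lambda^{[N]}_{N+1}$ are the zeros of $B_{N+1}$, the Christoffel coefficients, i.e.\ the masses of the discrete measures $\mu^{[N]}_a=\sum_{n=1}^{N+1}\mu^{[N]}_{n,a}\,\delta\big(x-\lambda^{[N]}_n\big)$, are \[ \mu^{[N]}_{n,a}=(-1)^{a-1}\,\frac{\det\big(A^{(b)}_{N+i}(\lambda^{[N]}_n)\big)_{1\leqslant i\leqslant p-1,\ b\in\{1,\dots,p\}\setminus\{a\}}}{\sum_{l=0}^{N}Q_{l,N}(\lambda^{[N]}_n)\,B_l(\lambda^{[N]}_n)} . \] \emph{Positive bidiagonal factorization.} Let $\alpha_i>0$, $i\geqslant 1$. For $M\geqslant 0$ and $k\in\{1,\dots,p\}$ let $L^{[M]}_k$ be the $(M+1)\times(M+1)$ lower bidiagonal matrix with unit diagonal and subdiagonal entries $(L^{[M]}_k)_{j+1,j}=\alpha_{k+1+j(p+1)}$, and let $U^{[M]}$ be the upper bidiagonal matrix with diagonal entries $(U^{[M]})_{j,j}=\alpha_{1+j(p+1)}$ and unit superdiagonal. Let $\mathscr L\in\mathbb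 R^{p\times p}$ be the matrix whose $k$-th column, $k\in\{1,\dots,p\}$, is $\mathscr L_k=\frac1{d_k}L^{[p-1]}_1\cdots L^{[p-1]}_{k-1}\,(1,0,\dots,0)^\top$ with $d_k=\alpha_k\alpha_{k+p}\cdots\alpha_{k+(k-2)p}$; for $k=1$ the products are empty, so that $\mathscr L_1=(1,0,\dots,0)^\top$. Suppose that $T^{[N]}=L^{[N]}_1L^{[N]}_2\cdots L^{[N]}_pU^{[N]}$ and that \[ \nu^{-\top}=\mathscr L\,\mathscr C \] for some entrywise nonnegative upper unitriangular matrix $\mathscr C\in\mathbb R^{p\times p}$. Then $B_{N+1}$ has $N+1$ distinct real zeros $\lambda^{[N]}_1>\dots>\lambda^{[N]}_{N+1}$, and \[ \mu^{[N]}_{n,a}>0,\qquad n\in\{1,\dots,N+1\},\quad a\in\{1,\dots,p\}. \] -/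

import Mathlib

open Polynomial Matrix

namespace BandedHessenberg

/-- `T` is a semi-infinite banded monic lower Hessenberg matrix with `p` subdiagonals: ones on the
first superdiagonal, zeros above it and below the `p`-th subdiagonal, and the entries of the
`p`-th subdiagonal do not vanish. -/
structure IsBandedMonicHessenberg (p : ℕ) (T : Matrix ℕ ℕ ℝ) : Prop where
  superdiag : ∀ n, T n (n + 1) = 1
  above : ∀ n m, n + 1 < m → T n m = 0
  below : ∀ n m, m + p < n → T n m = 0
  extreme : ∀ n, T (n + p) n ≠ 0

/-- The truncation `T^{[N]}`, the leading principal submatrix of size `N + 1`. -/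
def trunc (T : Matrix ℕ ℕ ℝ) (N : ℕ) : Matrix (Fin (N + 1)) (Fin (N + 1)) ℝ :=
  Matrix.of fun i j => T i j

/-- Type II recursion polynomials: `B_0 = 1` and `B_{n+1} = x B_n - ∑_{j ≤ n} T_{n,j} B_j`,
which is the `n`-th row of `T B = x B` for a monic lower Hessenberg matrix. -/
noncomputable def typeII (T : Matrix ℕ ℕ ℝ) : ℕ → ℝ[X]
  | 0 => 1
  | n + 1 => X * typeII T n - ∑ j : Fin (n + 1), C (T n j) * typeII T j

/-- Type I recursion polynomials `A^{(a+1)}_n`. The first `p` of them are the constants in the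
column `a` of `ν`; for `n = m + p` the polynomial `A_n` is found from the `m`-th column of
`A T = x A`, that is, `A_{m-1} + ∑_{i ≤ p} T_{m+i,m} A_{m+i} = x A_m` with `A_{-1} = 0`. -/
noncomputable def typeI {p : ℕ} [NeZero p] (T : Matrix ℕ ℕ ℝ) (ν : Matrix (Fin p) (Fin p) ℝ)
    (a : Fin p) (n : ℕ) : ℝ[X] :=
  if h : n < p then C (ν ⟨n, h⟩ a)
  else
    C (T n (n - p))⁻¹ *
      (X * typeI T ν a (n - p)
        - (if h0 : n = p then 0 else typeI T ν a (n - p - 1))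
        - ∑ i : Fin p, C (T (n - p + i) (n - p)) * typeI T ν a (n - p + i))
termination_by n
decreasing_by
  all_goals
    have hp : 0 < p := Nat.pos_of_ne_zero (NeZero.ne p)
    omega

/-- The polynomial `Q_{n,N}`: the determinant whose first row is `A^{(1)}_n, …, A^{(p)}_n` and
whose other rows are `A^{(1)}_{N+i}, …, A^{(p)}_{N+i}`, `i = 1, …, p - 1`. -/
noncomputable def Q {p : ℕ} [NeZero p] (T : Matrix ℕ ℕ ℝ) (ν : Matrix (Fin p) (Fin p) ℝ)
    (n N : ℕ) : ℝ[X] :=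
  (Matrix.of fun i b : Fin p => typeI T ν b (if (i : ℕ) = 0 then n else N + i)).det

/-- The increasing enumeration of the elements of `Fin p` other than `a`. -/
def skip {p : ℕ} (a : Fin p) (j : Fin (p - 1)) : Fin p :=
  if (j : ℕ) < a then ⟨j, by omega⟩ else ⟨j + 1, by omega⟩

/-- The Christoffel coefficient with index `a + 1` at the node `x`:
`(-1)^a det [A^{(b)}_{N+i}(x)]_{i = 1, …, p-1; b ≠ a+1} / ∑_{l ≤ N} Q_{l,N}(x) B_l(x)`. -/
noncomputable def christoffel {p : ℕ} [NeZero p] (T : Matrix ℕ ℕ ℝ)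
    (ν : Matrix (Fin p) (Fin p) ℝ) (N : ℕ) (x : ℝ) (a : Fin p) : ℝ :=
  (-1) ^ (a : ℕ) *
      (Matrix.of fun i j : Fin (p - 1) => (typeI T ν (skip a j) (N + 1 + i)).eval x).det /
    ∑ l ∈ Finset.range (N + 1), (Q T ν l N).eval x * (typeII T l).eval x

/-- The lower bidiagonal factor `L_k^{[N]}` (`k = 1, …, p`): unit diagonal and
`(L_k)_{j+1,j} = α_{k+1+j(p+1)}`. -/
def lowerFactor (p : ℕ) (α : ℕ → ℝ) (N k : ℕ) : Matrix (Fin (N + 1)) (Fin (N + 1)) ℝ :=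
  Matrix.of fun i j =>
    if i = j then 1 else if (i : ℕ) = j + 1 then α (k + 1 + j * (p + 1)) else 0

/-- The upper bidiagonal factor `U^{[N]}`: `U_{j,j} = α_{1+j(p+1)}` and unit superdiagonal. -/
def upperFactor (p : ℕ) (α : ℕ → ℝ) (N : ℕ) : Matrix (Fin (N + 1)) (Fin (N + 1)) ℝ :=
  Matrix.of fun i j =>
    if i = j then α (1 + j * (p + 1)) else if (j : ℕ) = i + 1 then 1 else 0

/-- The product `L_1^{[N]} L_2^{[N]} ⋯ L_k^{[N]}`. -/
def lowerProd (p : ℕ) (α : ℕ → ℝ) (N : ℕ) : ℕ → Matrix (Fin (N + 1)) (Fin (N + 1)) ℝ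
  | 0 => 1
  | k + 1 => lowerProd p α N k * lowerFactor p α N (k + 1)

/-- The parameters `α_1, α_2, …` give a positive bidiagonal factorization
`T^{[N]} = L_1^{[N]} ⋯ L_p^{[N]} U^{[N]}`. -/
structure IsPositiveBidiagonal (p : ℕ) (T : Matrix ℕ ℕ ℝ) (N : ℕ) (α : ℕ → ℝ) : Prop where
  pos : ∀ i, 1 ≤ i → 0 < α i
  factorization : trunc T N = lowerProd p α N p * upperFactor p α N

/-- The `p × p` matrix `𝓛`. Its column with index `k` (zero-based) is the first column of
`L_1^{[p-1]} ⋯ L_k^{[p-1]}` divided by `α_{k+1} α_{k+1+p} ⋯ α_{k+1+(k-1)p}`. -/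
noncomputable def scriptL (p : ℕ) [NeZero p] (α : ℕ → ℝ) : Matrix (Fin p) (Fin p) ℝ :=
  Matrix.of fun i k =>
    lowerProd p α (p - 1) k ⟨i, by omega⟩ 0 /
      ∏ r ∈ Finset.range k, α (k + 1 + r * p)

def IsLowerUnitriangular {p : ℕ} (M : Matrix (Fin p) (Fin p) ℝ) : Prop :=
  (∀ i, M i i = 1) ∧ ∀ i j, i < j → M i j = 0

def IsUpperUnitriangular {p : ℕ} (M : Matrix (Fin p) (Fin p) ℝ) : Prop :=
  (∀ i, M i i = 1) ∧ ∀ i j, j < i → M i j = 0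

end BandedHessenberg

namespace BandedHessenberg

/-! The factorization refines the recursion for `B_n` into bidiagonal steps with positive
coefficients (`stepPoly`). Each step preserves positivity of any alternating form on which
multiplication by `X` acts nonnegatively (`levelPos`, `crossPos`). The form `Im (conj f(z) g(z))`
excludes nonreal zeros of `B_{N+1}`, and the Wronskian excludes double ones.

The same recursion, run from the last index upwards, gives left vectors `w^{(k)} = w^{(0)} L_1 ⋯
L_k`; at a zero `x` of `B_{N+1}`, `w^{(0)}` is the left eigenvector of `T^{[N]}`. The Wronskian
shows that `w^{(k)}_0` has the sign of `B_{N+1}'(x)` for `k < p` (`leftVec_mul_derivative_pos`).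

At such `x`, `Q_{l,N}(x) = Q_{N,N}(x) w^{(0)}_l`, so by Christoffel–Darboux the denominator is
`Q_{N,N}(x) B_{N+1}'(x)`. Inverting `ν` turns the numerator into `Q_{N,N}(x) ∑_k (w^{(k)}_0 / d_k)
𝒞_{k,a}` (`christoffelNum_eq`). The factor `Q_{N,N}(x)` cancels and the quotient is positive. -/

/-! ### Alternating forms that stay positive along the bidiagonal recursion. -/

/-- The solution of `R_{n+1,0} = x R_{n,p} - a_{n,0} R_{n,0}` and
`R_{n+1,k+1} = R_{n+1,k} - a_{n,k+1} R_{n,k+1}` with `R_{0,k} = 1`. -/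
noncomputable def stepPoly (p : ℕ) (a : ℕ → ℕ → ℝ) : ℕ → ℕ → ℝ[X]
  | 0, _ => 1
  | n + 1, 0 => X * stepPoly p a n p - C (a n 0) * stepPoly p a n 0
  | n + 1, k + 1 => stepPoly p a (n + 1) k - C (a n (k + 1)) * stepPoly p a n (k + 1)

/-- An alternating bilinear form on real polynomials for which multiplication by `X` is
nonnegative in the sense of `nonneg_X`. -/
structure IsInterlacingForm (K : ℝ[X] →ₗ[ℝ] ℝ[X] →ₗ[ℝ] ℝ) (s : ℝ) : Prop where
  self : ∀ f, K f f = 0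
  nonneg_X : ∀ f, 0 ≤ K f (X * f)
  X_X : ∀ f g, K (X * f) (X * g) = s * K f g
  scale_nonneg : 0 ≤ s
  one_X : 0 < K 1 X

namespace IsInterlacingForm

variable {K : ℝ[X] →ₗ[ℝ] ℝ[X] →ₗ[ℝ] ℝ} {s : ℝ}

theorem swap (hK : IsInterlacingForm K s) (f g : ℝ[X]) : K g f = -K f g := by
  have h := hK.self (f + g)
  simp only [map_add, LinearMap.add_apply, hK.self] at h
  linarith

theorem sub_C_mul (hK : IsInterlacingForm K s) (f g h : ℝ[X]) (c : ℝ) :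
    K f (g - C c * h) = K f g + c * K h f := by
  rw [← smul_eq_C_mul, map_sub, map_smul, hK.swap h f, smul_eq_mul]
  ring

theorem X_mul_sub_C_mul (hK : IsInterlacingForm K s) (f g h : ℝ[X]) (c : ℝ) :
    K f (X * (g - C c * h)) = K f (X * g) + c * K (X * h) f := by
  rw [← hK.sub_C_mul]
  congr 1
  ring

variable {p : ℕ} {a : ℕ → ℕ → ℝ}

/-- Positivity of the form on pairs of positions of one level. -/
def LevelPos (K : ℝ[X] →ₗ[ℝ] ℝ[X] →ₗ[ℝ] ℝ) (p : ℕ) (a : ℕ → ℕ → ℝ) (n : ℕ) : Prop :=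
  ∀ i j, i < j → j ≤ p → 0 ≤ K (stepPoly p a n i) (stepPoly p a n j) ∧
    (0 < n → 0 < K (stepPoly p a n i) (stepPoly p a n j)) ∧
    0 < K (stepPoly p a n i) (X * stepPoly p a n j)

/-- Positivity of the form on pairs of positions of consecutive levels. -/
def CrossPos (K : ℝ[X] →ₗ[ℝ] ℝ[X] →ₗ[ℝ] ℝ) (p : ℕ) (a : ℕ → ℕ → ℝ) (n j : ℕ) : Prop :=
  ∀ i, j < i → i ≤ p → 0 < K (stepPoly p a n i) (stepPoly p a (n + 1) j) ∧
    0 < K (X * stepPoly p a n i) (stepPoly p a (n + 1) j)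

/-- For `i = p` the leading term `K R_p (X R_p)` is only nonnegative. Strictness then comes from `K
R_0 R_p` when `n > 0`, and from `one_X` at level `0`, where every polynomial is `1`. -/
theorem crossPos_zero (hK : IsInterlacingForm K s) (ha : ∀ n k, 0 < a n k) {n : ℕ}
    (h : LevelPos K p a n) : CrossPos K p a n 0 := by
  intro i hi hip
  obtain ⟨h1, h2, h3⟩ := h 0 i hi hip
  have ha0 := ha n 0
  simp only [stepPoly]
  rw [hK.sub_C_mul, hK.sub_C_mul, hK.X_X]
  rcases hip.lt_or_eq with hlt | rfl
  · obtain ⟨g1, g2, g3⟩ := h i p hlt le_rfl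
    have := hK.scale_nonneg
    exact ⟨by positivity, by positivity⟩
  · rw [hK.self, mul_zero]
    refine ⟨?_, by positivity⟩
    have h4 := hK.nonneg_X (stepPoly i a n i)
    rcases n.eq_zero_or_pos with rfl | hn
    · simpa [stepPoly, hK.self] using hK.one_X
    · have := h2 hn
      positivity

theorem crossPos_succ (hK : IsInterlacingForm K s) (ha : ∀ n k, 0 < a n k) {n j : ℕ}
    (h : LevelPos K p a n) (hj : CrossPos K p a n j) : CrossPos K p a n (j + 1) := by
  intro i hi hip
  obtain ⟨h1, h2, h3⟩ := h (j + 1) i hi hip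
  obtain ⟨g1, g2⟩ := hj i (by omega) hip
  have ha0 := ha n (j + 1)
  simp only [stepPoly]
  rw [hK.sub_C_mul, hK.sub_C_mul]
  exact ⟨by positivity, by positivity⟩

theorem crossPos (hK : IsInterlacingForm K s) (ha : ∀ n k, 0 < a n k) {n : ℕ}
    (h : LevelPos K p a n) (j : ℕ) : CrossPos K p a n j := by
  induction j with
  | zero => exact hK.crossPos_zero ha h
  | succ j ih => exact hK.crossPos_succ ha h ih

/-- Induction on the level, then on the right position: unfolding `R_{n+1,j+1}` leaves the pair `(i,
j)` of the same level plus a positive multiple of a cross term, and the cross term supplies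
strictness. -/
theorem levelPos (hK : IsInterlacingForm K s) (ha : ∀ n k, 0 < a n k) (n : ℕ) :
    LevelPos K p a n := by
  induction n with
  | zero =>
    intro i j _ _
    simp [stepPoly, hK.self, hK.one_X]
  | succ n ih =>
    intro i j
    induction j with
    | zero => intro h; omega
    | succ j ihj =>
      intro hij hjp
      obtain ⟨h1, h2⟩ := hK.crossPos ha ih i (j + 1) hij hjp
      have ha0 := ha n (j + 1)
      have e : stepPoly p a (n + 1) (j + 1)
        = stepPoly p a (n + 1) j - C (a n (j + 1)) * stepPoly p a n (j + 1) := by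
        simp only [stepPoly]
      rw [e, hK.sub_C_mul, hK.X_mul_sub_C_mul]
      rcases (Nat.lt_succ_iff.mp hij).lt_or_eq with hlt | rfl
      · obtain ⟨g1, -, g3⟩ := ihj hlt (by omega)
        exact ⟨by positivity, fun _ => by positivity, by positivity⟩
      · have := hK.nonneg_X (stepPoly p a (n + 1) i)
        rw [hK.self, zero_add]
        exact ⟨by positivity, fun _ => by positivity, by positivity⟩

theorem pos_of_pos (hK : IsInterlacingForm K s) (ha : ∀ n k, 0 < a n k) (n : ℕ) {i : ℕ}
    (hi : 0 < i) (hip : i ≤ p) : 0 < K (stepPoly p a n i) (stepPoly p a (n + 1) 0) :=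
  (hK.crossPos ha (hK.levelPos ha n) 0 i hi hip).1

/-- Position `0` lies outside `CrossPos`, but here the subtracted multiple of `R_{n,0}` pairs to
zero with itself. -/
theorem pos_zero (hK : IsInterlacingForm K s) (ha : ∀ n k, 0 < a n k) (hp : 0 < p) (n : ℕ) :
    0 < K (stepPoly p a n 0) (stepPoly p a (n + 1) 0) := by
  have h := (hK.levelPos ha n 0 p hp le_rfl).2.2
  simp only [stepPoly]
  rwa [hK.sub_C_mul, hK.self, mul_zero, add_zero]

end IsInterlacingForm

/-! ### The two forms, and real simple zeros. -/

/-- The Wronskian `f g' - f' g` at a real point, as a bilinear form. -/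
noncomputable def wronskianForm (x : ℝ) : ℝ[X] →ₗ[ℝ] ℝ[X] →ₗ[ℝ] ℝ :=
  LinearMap.mk₂ ℝ (fun f g => f.eval x * (derivative g).eval x - (derivative f).eval x * g.eval x)
    (by intros; simp; ring) (by intros; simp; ring) (by intros; simp; ring) (by intros; simp; ring)

theorem wronskianForm_apply (x : ℝ) (f g : ℝ[X]) : wronskianForm x f g =
    f.eval x * (derivative g).eval x - (derivative f).eval x * g.eval x := rfl

theorem isInterlacingForm_wronskianForm (x : ℝ) :
    IsInterlacingForm (wronskianForm x) (x ^ 2) where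
  self f := by rw [wronskianForm_apply]; ring
  nonneg_X f := by
    have : wronskianForm x f (X * f) = f.eval x ^ 2 := by
      simp [wronskianForm_apply]; ring
    rw [this]; positivity
  X_X f g := by simp [wronskianForm_apply]; ring
  scale_nonneg := sq_nonneg x
  one_X := by simp [wronskianForm_apply]

/-- The form `Im (conj f(z) g(z))`. -/
noncomputable def imForm (z : ℂ) : ℝ[X] →ₗ[ℝ] ℝ[X] →ₗ[ℝ] ℝ :=
  LinearMap.mk₂ ℝ (fun f g => (aeval z f).re * (aeval z g).im - (aeval z f).im * (aeval z g).re)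
    (by intros; simp; ring) (by intros; simp; ring) (by intros; simp; ring) (by intros; simp; ring)

theorem imForm_apply (z : ℂ) (f g : ℝ[X]) : imForm z f g =
    (aeval z f).re * (aeval z g).im - (aeval z f).im * (aeval z g).re := rfl

theorem isInterlacingForm_imForm {z : ℂ} (hz : 0 < z.im) :
    IsInterlacingForm (imForm z) (z.re ^ 2 + z.im ^ 2) where
  self f := by rw [imForm_apply]; ring
  nonneg_X f := by
    have : imForm z f (X * f) = ((aeval z f).re ^ 2 + (aeval z f).im ^ 2) * z.im := by
      simp [imForm_apply]; ring
    rw [this]; positivity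
  X_X f g := by simp [imForm_apply]; ring
  scale_nonneg := by positivity
  one_X := by simpa [imForm_apply] using hz

theorem stepPoly_monic_and_natDegree (p : ℕ) (a : ℕ → ℕ → ℝ) (n : ℕ) :
    ∀ k, (stepPoly p a n k).Monic ∧ (stepPoly p a n k).natDegree = n := by
  induction n with
  | zero => intro k; simp [stepPoly]
  | succ n ih =>
    have key : ∀ (f : ℝ[X]) (c : ℝ) (k : ℕ), f.Monic → f.natDegree = n + 1 →
        (f - C c * stepPoly p a n k).Monic ∧ (f - C c * stepPoly p a n k).natDegree = n + 1 := by
      intro f c k hf hn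
      have hd : (C c * stepPoly p a n k).degree < f.degree := by
        rw [← smul_eq_C_mul]
        refine lt_of_le_of_lt (degree_smul_le _ _) ?_
        rw [degree_eq_natDegree hf.ne_zero, degree_eq_natDegree (ih k).1.ne_zero, hn, (ih k).2]
        exact_mod_cast Nat.lt_succ_self n
      exact ⟨hf.sub_of_left hd, by
        rw [natDegree_eq_of_degree_eq (degree_sub_eq_left_of_degree_lt hd), hn]⟩
    intro k
    induction k with
    | zero =>
      simp only [stepPoly]
      refine key _ _ _ (monic_X.mul (ih p).1) ?_
      rw [natDegree_X_mul (ih p).1.ne_zero, (ih p).2]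
    | succ k ihk =>
      simp only [stepPoly]
      exact key _ _ _ ihk.1 ihk.2

/-- A monic real polynomial without zeros in the open upper half plane and without double real
zeros is a product over a strictly decreasing enumeration of its zeros. -/
theorem exists_strictAnti_prod {P : ℝ[X]} {n : ℕ} (hP : P.Monic) (hn : P.natDegree = n)
    (him : ∀ z : ℂ, 0 < z.im → aeval z P ≠ 0)
    (hsimple : ∀ x, P.eval x = 0 → (derivative P).eval x ≠ 0) :
    ∃ lam : Fin n → ℝ, StrictAnti lam ∧ P = ∏ i, (X - C (lam i)) := by
  have hreal : ∀ z : ℂ, aeval z P = 0 → z.im = 0 := by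
    intro z hz
    rcases lt_trichotomy z.im 0 with h | h | h
    · refine absurd ?_ (him (starRingEnd ℂ z) (by simpa using h))
      rw [aeval_conj, hz, map_zero]
    · exact h
    · exact absurd hz (him z h)
  have hsplit : P.Splits := by
    refine Splits.of_splits_map_of_injective (algebraMap ℝ ℂ).injective (IsAlgClosed.splits _) ?_
    intro z hz
    have hz' : aeval z P = 0 := by
      rw [← eval_map_algebraMap]
      exact isRoot_of_mem_roots hz
    exact ⟨z.re, Complex.ext rfl (hreal z hz').symm⟩
  have hnodup : P.roots.Nodup := by
    rw [Multiset.nodup_iff_count_le_one]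
    intro x
    rw [count_roots]
    by_contra! h
    obtain ⟨h1, h2⟩ := (one_lt_rootMultiplicity_iff_isRoot hP.ne_zero).mp h
    exact hsimple x h1 h2
  have hcard : P.roots.toFinset.card = n := by
    rw [Multiset.toFinset_card_of_nodup hnodup, ← hn, hsplit.natDegree_eq_card_roots]
  let e := P.roots.toFinset.orderEmbOfFin hcard
  refine ⟨fun i => e i.rev, fun i j hij => e.strictMono (Fin.rev_lt_rev.mpr hij), ?_⟩
  calc P = (P.roots.map fun x => X - C x).prod := hsplit.eq_prod_roots_of_monic hP
    _ = ∏ x ∈ P.roots.toFinset, (X - C x) := by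
      rw [Finset.prod, Multiset.toFinset_val, Multiset.dedup_eq_self.mpr hnodup]
    _ = ∏ i, (X - C (e i)) := by
      rw [← Finset.map_orderEmbOfFin_univ P.roots.toFinset hcard, Finset.prod_map]
      rfl
    _ = ∏ i : Fin n, (X - C (e i.rev)) :=
      (Equiv.prod_comp Fin.revPerm fun i => X - C (e i)).symm

/-! ### Action of the bidiagonal factors and of the truncation on vectors. -/

variable {p N : ℕ} {T : Matrix ℕ ℕ ℝ} {α : ℕ → ℝ}

theorem lowerFactor_mulVec_zero (k : ℕ) (v : ℕ → ℝ) :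
    (lowerFactor p α N k *ᵥ fun j => v j) 0 = v 0 := by
  rw [mulVec, dotProduct, Finset.sum_eq_single 0] <;> simp +contextual [lowerFactor, eq_comm]

theorem lowerFactor_mulVec_succ (k : ℕ) (v : ℕ → ℝ) {m : ℕ} (hm : m + 1 < N + 1) :
    (lowerFactor p α N k *ᵥ fun j => v j) ⟨m + 1, hm⟩ =
      v (m + 1) + α (k + 1 + m * (p + 1)) * v m := by
  have h : ∀ j : Fin (N + 1), lowerFactor p α N k ⟨m + 1, hm⟩ j * v j =
      (if (j : ℕ) = m + 1 then v j else 0)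
        + (if (j : ℕ) = m then α (k + 1 + j * (p + 1)) * v j else 0) := by
    intro j
    simp only [lowerFactor, of_apply, Fin.ext_iff]
    split_ifs <;> first | omega | simp
  simp only [mulVec, dotProduct, h]
  rw [Fin.sum_univ_eq_sum_range fun j => (if j = m + 1 then v j else 0)
        + (if j = m then α (k + 1 + j * (p + 1)) * v j else 0), Finset.sum_add_distrib,
    Finset.sum_ite_eq', Finset.sum_ite_eq', if_pos (by simpa using hm),
    if_pos (by simp; omega)]

theorem vecMul_lowerFactor (k : ℕ) (v : ℕ → ℝ) (hv : v (N + 1) = 0) (j : Fin (N + 1)) :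
    ((fun i : Fin (N + 1) => v i) ᵥ* lowerFactor p α N k) j =
      v j + v (j + 1) * α (k + 1 + j * (p + 1)) := by
  have h : ∀ i : Fin (N + 1), v i * lowerFactor p α N k i j =
      (if (i : ℕ) = j then v i else 0)
        + (if (i : ℕ) = j + 1 then v i * α (k + 1 + j * (p + 1)) else 0) := by
    intro i
    simp only [lowerFactor, of_apply, Fin.ext_iff]
    split_ifs <;> first | omega | simp
  simp only [vecMul, dotProduct, h]
  rw [Fin.sum_univ_eq_sum_range fun i => (if i = (j : ℕ) then v i else 0)
        + (if i = (j : ℕ) + 1 then v i * α (k + 1 + j * (p + 1)) else 0), Finset.sum_add_distrib,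
    Finset.sum_ite_eq', Finset.sum_ite_eq', if_pos (by simp; omega)]
  split_ifs with hj
  · rfl
  · have : (j : ℕ) = N := by have := j.2; simp at hj; omega
    rw [this, hv, zero_mul]

theorem upperFactor_mulVec (v : ℕ → ℝ) (i : Fin (N + 1)) :
    (upperFactor p α N *ᵥ fun j => v j) i =
      α (1 + i * (p + 1)) * v i + if (i : ℕ) < N then v (i + 1) else 0 := by
  have h : ∀ j : Fin (N + 1), upperFactor p α N i j * v j =
      (if (j : ℕ) = i then α (1 + j * (p + 1)) * v j else 0)
        + (if (j : ℕ) = i + 1 then v j else 0) := by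
    intro j
    simp only [upperFactor, of_apply, Fin.ext_iff]
    split_ifs <;> first | omega | simp
  simp only [mulVec, dotProduct, h]
  rw [Fin.sum_univ_eq_sum_range fun j => (if j = (i : ℕ) then α (1 + j * (p + 1)) * v j else 0)
        + (if j = (i : ℕ) + 1 then v j else 0), Finset.sum_add_distrib,
    Finset.sum_ite_eq', Finset.sum_ite_eq', if_pos (by simp; omega)]
  simp

theorem vecMul_upperFactor_zero (v : ℕ → ℝ) :
    ((fun i : Fin (N + 1) => v i) ᵥ* upperFactor p α N) 0 = v 0 * α 1 := by
  rw [vecMul, dotProduct, Finset.sum_eq_single 0] <;> simp +contextual [upperFactor]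

theorem vecMul_upperFactor_succ (v : ℕ → ℝ) {m : ℕ} (hm : m + 1 < N + 1) :
    ((fun i : Fin (N + 1) => v i) ᵥ* upperFactor p α N) ⟨m + 1, hm⟩ =
      v (m + 1) * α (1 + (m + 1) * (p + 1)) + v m := by
  have h : ∀ i : Fin (N + 1), v i * upperFactor p α N i ⟨m + 1, hm⟩ =
      (if (i : ℕ) = m + 1 then v i * α (1 + (m + 1) * (p + 1)) else 0)
        + (if (i : ℕ) = m then v i else 0) := by
    intro i
    simp only [upperFactor, of_apply, Fin.ext_iff]
    split_ifs with h1 <;> first | omega | simp [h1]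
  simp only [vecMul, dotProduct, h]
  rw [Fin.sum_univ_eq_sum_range fun i =>
        (if i = m + 1 then v i * α (1 + (m + 1) * (p + 1)) else 0)
        + (if i = m then v i else 0), Finset.sum_add_distrib,
    Finset.sum_ite_eq', Finset.sum_ite_eq', if_pos (by simpa using hm),
    if_pos (by simp; omega)]

theorem lowerFactor_mulVec_single_last (k : ℕ) (c : ℝ) :
    lowerFactor p α N k *ᵥ Pi.single (Fin.last N) c = Pi.single (Fin.last N) c := by
  ext i
  rw [mulVec_single, Pi.single_apply]
  have := i.2
  simp only [lowerFactor, Fin.ext_iff, Fin.val_last, of_apply, col_apply, Pi.smul_apply,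
    MulOpposite.smul_eq_mul_unop, MulOpposite.unop_op]
  split_ifs <;> first | omega | simp

theorem lowerProd_mulVec_single_last (k : ℕ) (c : ℝ) :
    lowerProd p α N k *ᵥ Pi.single (Fin.last N) c = Pi.single (Fin.last N) c := by
  induction k with
  | zero => rw [lowerProd, one_mulVec]
  | succ k ih => rw [lowerProd, ← mulVec_mulVec, lowerFactor_mulVec_single_last, ih]

theorem trunc_mulVec (hT : IsBandedMonicHessenberg p T) (v : ℕ → ℝ) (i : Fin (N + 1)) :
    (trunc T N *ᵥ fun j => v j) i =
      (∑ j ∈ Finset.range (i + 1), T i j * v j) + if (i : ℕ) < N then v (i + 1) else 0 := by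
  simp only [mulVec, dotProduct, trunc, of_apply]
  rw [Fin.sum_univ_eq_sum_range fun j => T i j * v j]
  split_ifs with h
  · rw [← Finset.sum_subset (Finset.range_subset_range.mpr (by omega : (i : ℕ) + 2 ≤ N + 1)),
      Finset.sum_range_succ _ ((i : ℕ) + 1), hT.superdiag, one_mul]
    intro j _ hj
    rw [hT.above _ _ (by simp at hj; omega), zero_mul]
  · rw [show (i : ℕ) = N by omega, add_zero]

/-! ### Right vectors and the type II polynomials. -/

/-- The recursion polynomials of the matrices `L_{k+1} ⋯ L_p U L_1 ⋯ L_k`. -/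
noncomputable def rightPoly (p : ℕ) (α : ℕ → ℝ) (n k : ℕ) : ℝ[X] :=
  stepPoly p (fun n k => α (k + 1 + n * (p + 1))) n k

theorem lowerFactor_mulVec_rightPoly (y : ℝ) (k : ℕ) :
    (lowerFactor p α N (k + 1) *ᵥ fun j => (rightPoly p α j (k + 1)).eval y) =
      fun j : Fin (N + 1) => (rightPoly p α j k).eval y := by
  ext ⟨m, hm⟩
  cases m with
  | zero =>
    refine (lowerFactor_mulVec_zero _ fun j => (rightPoly p α j (k + 1)).eval y).trans ?_
    simp [rightPoly, stepPoly]
  | succ m =>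
    refine (lowerFactor_mulVec_succ _ (fun j => (rightPoly p α j (k + 1)).eval y) hm).trans ?_
    simp [rightPoly, stepPoly]

theorem lowerProd_mulVec_rightPoly (y : ℝ) (k : ℕ) :
    (lowerProd p α N k *ᵥ fun j => (rightPoly p α j k).eval y) =
      fun j : Fin (N + 1) => (rightPoly p α j 0).eval y := by
  induction k with
  | zero => simp [lowerProd]
  | succ k ih => rw [lowerProd, ← mulVec_mulVec, lowerFactor_mulVec_rightPoly, ih]

theorem upperFactor_mulVec_rightPoly (y : ℝ) :
    (upperFactor p α N *ᵥ fun j => (rightPoly p α j 0).eval y) =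
      y • (fun j : Fin (N + 1) => (rightPoly p α j p).eval y)
        - Pi.single (Fin.last N) ((rightPoly p α (N + 1) 0).eval y) := by
  ext i
  refine (upperFactor_mulVec (fun j => (rightPoly p α j 0).eval y) i).trans ?_
  have hi := i.2
  by_cases h : (i : ℕ) < N
  · have : i ≠ Fin.last N := fun e => by simp [e] at h
    simp [h, this, rightPoly, stepPoly]
  · obtain rfl : i = Fin.last N := Fin.ext (by simp; omega)
    simp [rightPoly, stepPoly, add_comm]

theorem trunc_mulVec_rightPoly (hα : IsPositiveBidiagonal p T N α) (y : ℝ) :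
    (trunc T N *ᵥ fun j => (rightPoly p α j 0).eval y) =
      y • (fun j : Fin (N + 1) => (rightPoly p α j 0).eval y)
        - Pi.single (Fin.last N) ((rightPoly p α (N + 1) 0).eval y) := by
  rw [hα.factorization, ← mulVec_mulVec, upperFactor_mulVec_rightPoly, mulVec_sub, mulVec_smul,
    lowerProd_mulVec_rightPoly, lowerProd_mulVec_single_last]

/-- Row `n` of `trunc_mulVec_rightPoly` is the recursion for `B_{n+1}`; in row `N` the boundary term
plays the role of `B_{N+1}`. The factorization is given only at size `N + 1`, hence the bound on
`n`. -/
theorem typeII_eq_rightPoly (hT : IsBandedMonicHessenberg p T)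
    (hα : IsPositiveBidiagonal p T N α) (n : ℕ) (hn : n ≤ N + 1) :
    typeII T n = rightPoly p α n 0 := by
  induction n using Nat.strong_induction_on with
  | _ n ih =>
    cases n with
    | zero => simp [typeII, rightPoly, stepPoly]
    | succ n =>
      refine Polynomial.funext fun y => ?_
      have h := congrFun (trunc_mulVec_rightPoly hα y) ⟨n, by omega⟩
      rw [trunc_mulVec hT (fun j => (rightPoly p α j 0).eval y)] at h
      have e : ∀ j : Fin (n + 1), typeII T j = rightPoly p α j 0 := fun j =>
        ih j (by omega) (by omega)
      rw [typeII, ih n (by omega) (by omega)]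
      simp only [e, eval_sub, eval_mul, eval_X, eval_finsetSum, eval_C]
      rw [Fin.sum_univ_eq_sum_range fun j => T n j * (rightPoly p α j 0).eval y]
      rcases (Nat.lt_succ_iff.mp hn).lt_or_eq with hlt | rfl
      · have : (⟨n, by omega⟩ : Fin (N + 1)) ≠ Fin.last N := by simp [Fin.ext_iff]; omega
        simp only [hlt, if_true, Pi.sub_apply, Pi.smul_apply, smul_eq_mul, Pi.single_apply, this,
          if_false, sub_zero] at h
        linarith
      · have : (⟨n, by omega⟩ : Fin (n + 1)) = Fin.last n := rfl
        simp only [lt_irrefl, if_false, Pi.sub_apply, Pi.smul_apply, smul_eq_mul, Pi.single_apply,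
          this, if_true, add_zero, Fin.val_last] at h
        linarith

/-! ### Left vectors and the Christoffel–Darboux identity. -/

/-- The coefficients of the recursion for left vectors, read from the last entry upwards. -/
def leftCoeff (p : ℕ) (α : ℕ → ℝ) (N n i : ℕ) : ℝ := α (1 + ((N - n) * (p + 1) - i))

/-- The vectors `w^{(k)} = w^{(0)} L_1 ⋯ L_k`, where `w^{(0)}` solves the left eigenvector
equations of `T^{[N]}` except for column `0` and has last entry `1`. -/
noncomputable def leftVec (p : ℕ) (α : ℕ → ℝ) (N : ℕ) (x : ℝ) (k l : ℕ) : ℝ :=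
  if l ≤ N then (stepPoly p (leftCoeff p α N) (N - l) (p - k)).eval x else 0

theorem leftVec_vecMul_lowerFactor (x : ℝ) {k : ℕ} (hk : k < p) :
    (fun i : Fin (N + 1) => leftVec p α N x k i) ᵥ* lowerFactor p α N (k + 1) =
      fun i : Fin (N + 1) => leftVec p α N x (k + 1) i := by
  ext j
  rw [vecMul_lowerFactor _ _ (by simp [leftVec])]
  have hj := j.2
  rcases (Nat.lt_succ_iff.mp hj).lt_or_eq with hlt | heq
  · obtain ⟨m, hm⟩ : ∃ m, N = j + 1 + m := ⟨N - (j + 1), by omega⟩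
    obtain ⟨q, hq⟩ : ∃ q, p = k + 1 + q := ⟨p - (k + 1), by omega⟩
    have e1 : N - j = m + 1 := by omega
    have e2 : N - (j + 1) = m := by omega
    have e3 : p - k = q + 1 := by omega
    have e4 : p - (k + 1) = q := by omega
    have e5 : N - m = j + 1 := by omega
    -- The truncated subtraction in `leftCoeff` is exact here, since `q + 1 ≤ p`.
    have e6 : 1 + (((j : ℕ) + 1) * (p + 1) - (q + 1)) = k + 1 + 1 + j * (p + 1) := by
      rw [Nat.add_mul, one_mul]; omega
    simp only [leftVec, if_pos hlt.le, if_pos (Nat.succ_le_of_lt hlt), e1, e2, e3, e4, stepPoly,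
      leftCoeff, e5, e6, eval_sub, eval_mul, eval_C]
    ring
  · simp [leftVec, heq, stepPoly]

theorem leftVec_vecMul_lowerProd (x : ℝ) {k : ℕ} (hk : k ≤ p) :
    (fun i : Fin (N + 1) => leftVec p α N x 0 i) ᵥ* lowerProd p α N k =
      fun i : Fin (N + 1) => leftVec p α N x k i := by
  induction k with
  | zero => simp [lowerProd]
  | succ k ih =>
    rw [lowerProd, ← vecMul_vecMul, ih (by omega), leftVec_vecMul_lowerFactor x (by omega)]

theorem leftVec_vecMul_upperFactor (x : ℝ) :
    (fun i : Fin (N + 1) => leftVec p α N x p i) ᵥ* upperFactor p α N =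
      x • (fun i : Fin (N + 1) => leftVec p α N x 0 i)
        - Pi.single 0 ((stepPoly p (leftCoeff p α N) (N + 1) 0).eval x) := by
  ext ⟨m, hm⟩
  cases m with
  | zero =>
    refine (vecMul_upperFactor_zero (leftVec p α N x p)).trans ?_
    simp [leftVec, stepPoly, leftCoeff, mul_comm]
  | succ m =>
    refine (vecMul_upperFactor_succ (leftVec p α N x p) hm).trans ?_
    have h1 : m ≤ N := by omega
    have h2 : m + 1 ≤ N := by omega
    have e1 : N - m = (N - (m + 1)) + 1 := by omega
    have e2 : N - (N - (m + 1)) = m + 1 := by omega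
    simp [leftVec, h1, h2, e1, stepPoly, leftCoeff, e2, Fin.ext_iff]
    ring

theorem leftVec_vecMul_trunc (hα : IsPositiveBidiagonal p T N α) (x : ℝ) :
    (fun i : Fin (N + 1) => leftVec p α N x 0 i) ᵥ* trunc T N =
      x • (fun i : Fin (N + 1) => leftVec p α N x 0 i)
        - Pi.single 0 ((stepPoly p (leftCoeff p α N) (N + 1) 0).eval x) := by
  rw [hα.factorization, ← vecMul_vecMul, leftVec_vecMul_lowerProd x le_rfl,
    leftVec_vecMul_upperFactor]

/-- A Christoffel–Darboux identity for the left and right recursion vectors. -/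
theorem rightPoly_eval_eq (hα : IsPositiveBidiagonal p T N α) (x y : ℝ) :
    (rightPoly p α (N + 1) 0).eval y = (stepPoly p (leftCoeff p α N) (N + 1) 0).eval x
      + (y - x) * ∑ l ∈ Finset.range (N + 1), leftVec p α N x 0 l * (rightPoly p α l 0).eval y := by
  have h := dotProduct_mulVec (fun i : Fin (N + 1) => leftVec p α N x 0 i) (trunc T N)
    (fun j => (rightPoly p α j 0).eval y)
  rw [trunc_mulVec_rightPoly hα, leftVec_vecMul_trunc hα, dotProduct_sub, sub_dotProduct,
    dotProduct_smul, smul_dotProduct, dotProduct_single, single_dotProduct] at h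
  have e := Fin.sum_univ_eq_sum_range
    (fun l => leftVec p α N x 0 l * (rightPoly p α l 0).eval y) (N + 1)
  rw [← e]
  simp only [dotProduct, smul_eq_mul] at h
  have h1 : leftVec p α N x 0 (Fin.last N) = 1 := by simp [leftVec, stepPoly]
  have h2 : (rightPoly p α (0 : Fin (N + 1)) 0).eval y = 1 := by simp [rightPoly, stepPoly]
  rw [h1, h2] at h
  linarith

theorem rightPoly_eq_stepPoly_left (hα : IsPositiveBidiagonal p T N α) :
    rightPoly p α (N + 1) 0 = stepPoly p (leftCoeff p α N) (N + 1) 0 :=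
  Polynomial.funext fun x => by simpa using rightPoly_eval_eq hα x x

/-- At a zero `x` the Christoffel–Darboux sum is the cofactor of `X - C x`. This identifies the
denominator of the Christoffel coefficients. -/
theorem derivative_rightPoly_eval (hα : IsPositiveBidiagonal p T N α) {x : ℝ}
    (hx : (rightPoly p α (N + 1) 0).eval x = 0) :
    (derivative (rightPoly p α (N + 1) 0)).eval x =
      ∑ l ∈ Finset.range (N + 1), leftVec p α N x 0 l * (rightPoly p α l 0).eval x := by
  have h : rightPoly p α (N + 1) 0 =
      (X - C x) * ∑ l ∈ Finset.range (N + 1), C (leftVec p α N x 0 l) * rightPoly p α l 0 := by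
    refine Polynomial.funext fun y => ?_
    rw [rightPoly_eval_eq hα x y, ← rightPoly_eq_stepPoly_left hα, hx]
    simp [eval_finsetSum]
  rw [h]
  simp [derivative_mul, eval_finsetSum]

/-! ### Type I polynomials as solutions of the left recursion. -/

theorem typeI_of_lt [NeZero p] (ν : Matrix (Fin p) (Fin p) ℝ) (a l : Fin p) :
    typeI T ν a l = C (ν l a) := by
  rw [typeI, dif_pos l.2]

theorem sum_typeI_mul_column [NeZero p] (hT : IsBandedMonicHessenberg p T)
    (ν : Matrix (Fin p) (Fin p) ℝ) (a : Fin p) (x : ℝ) (n : ℕ) :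
    ∑ l ∈ Finset.range (n + p + 1), (typeI T ν a l).eval x * T l n =
      x * (typeI T ν a n).eval x := by
  have h : (typeI T ν a (n + p)).eval x * T (n + p) n =
      x * (typeI T ν a n).eval x - (if n = 0 then 0 else (typeI T ν a (n - 1)).eval x)
        - ∑ i ∈ Finset.range p, (typeI T ν a (n + i)).eval x * T (n + i) n := by
    rw [typeI, dif_neg (by omega)]
    have hx := hT.extreme n
    simp only [Nat.add_sub_cancel, Nat.add_eq_right, eval_mul, eval_sub, eval_C, eval_X,
      eval_finsetSum]
    rw [Fin.sum_univ_eq_sum_range fun i => T (n + i) n * (typeI T ν a (n + i)).eval x]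
    simp only [mul_comm (T _ _)]
    field_simp
    split_ifs <;> simp
  rw [Finset.sum_range_succ, h, Finset.sum_range_add]
  have h0 : ∑ l ∈ Finset.range n, (typeI T ν a l).eval x * T l n =
      if n = 0 then 0 else (typeI T ν a (n - 1)).eval x := by
    cases n with
    | zero => simp
    | succ n =>
      rw [Finset.sum_range_succ, hT.superdiag, Finset.sum_eq_zero]
      · simp
      · intro l hl
        rw [hT.above _ _ (by simp at hl; omega), mul_zero]
  rw [h0]
  ring

/-- The combination of the type I polynomials with coefficients `c`, evaluated at `x`. -/
noncomputable def typeIComb [NeZero p] (T : Matrix ℕ ℕ ℝ) (ν : Matrix (Fin p) (Fin p) ℝ)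
    (c : Fin p → ℝ) (x : ℝ) (l : ℕ) : ℝ :=
  ∑ a, c a * (typeI T ν a l).eval x

theorem sum_typeIComb_mul_column [NeZero p] (hT : IsBandedMonicHessenberg p T)
    (ν : Matrix (Fin p) (Fin p) ℝ) (c : Fin p → ℝ) (x : ℝ) (n : ℕ) :
    ∑ l ∈ Finset.range (n + p + 1), typeIComb T ν c x l * T l n = x * typeIComb T ν c x n := by
  simp only [typeIComb, Finset.sum_mul, Finset.mul_sum]
  rw [Finset.sum_comm]
  refine Finset.sum_congr rfl fun a _ => ?_
  have h := congrArg (c a * ·) (sum_typeI_mul_column hT ν a x n)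
  simp only [Finset.mul_sum] at h
  rw [← mul_assoc, mul_comm x, mul_assoc, ← h]
  exact Finset.sum_congr rfl fun _ _ => by ring

theorem vecMul_trunc_apply (v : ℕ → ℝ) (j : Fin (N + 1)) :
    ((fun i : Fin (N + 1) => v i) ᵥ* trunc T N) j =
      ∑ l ∈ Finset.range (N + 1), v l * T l j := by
  simp only [vecMul, dotProduct, trunc, of_apply]
  exact Fin.sum_univ_eq_sum_range (fun l => v l * T l j) (N + 1)

/-- The terms cut off by truncation vanish: by `h0` up to row `N + p - 1`, by the band from row `N +
p` on. Column `N` is excluded because it reaches row `N + p`. -/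
theorem vecMul_trunc_of_sum_column (hT : IsBandedMonicHessenberg p T) {x : ℝ} {v : ℕ → ℝ}
    (hv : ∀ n, ∑ l ∈ Finset.range (n + p + 1), v l * T l n = x * v n)
    (h0 : ∀ i, i + 1 < p → v (N + 1 + i) = 0) {j : Fin (N + 1)} (hj : (j : ℕ) < N) :
    ((fun i : Fin (N + 1) => v i) ᵥ* trunc T N) j = x * v j := by
  rw [vecMul_trunc_apply, ← hv]
  trans ∑ l ∈ Finset.range (N + 1 + p), v l * T l j
  · refine Finset.sum_subset (Finset.range_subset_range.mpr (by omega)) fun l hl hl' => ?_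
    simp only [Finset.mem_range, not_lt] at hl hl'
    obtain ⟨i, rfl⟩ := Nat.exists_eq_add_of_le hl'
    by_cases hi : i + 1 < p
    · rw [h0 i hi, zero_mul]
    · rw [hT.below _ _ (by omega), mul_zero]
  · refine (Finset.sum_subset (Finset.range_subset_range.mpr (by omega)) fun l _ hl' => ?_).symm
    simp only [Finset.mem_range, not_lt] at hl'
    rw [hT.below _ _ (by omega), mul_zero]

/-- The unit superdiagonal lets column `l + 1` determine `u l` from later entries, so a left
eigenvector is fixed by its last entry. -/
theorem eq_zero_of_vecMul_trunc (hT : IsBandedMonicHessenberg p T) {x : ℝ} {u : ℕ → ℝ}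
    (hu : ∀ j : Fin (N + 1), ((fun i : Fin (N + 1) => u i) ᵥ* trunc T N) j = x * u j)
    (hN : u N = 0) (d : ℕ) : ∀ l, l + d = N → u l = 0 := by
  induction d using Nat.strong_induction_on with
  | _ d ih =>
    intro l hl
    cases d with
    | zero => rwa [show l = N by omega]
    | succ d =>
      have h := hu ⟨l + 1, by omega⟩
      rw [vecMul_trunc_apply, Finset.sum_eq_single l] at h
      · simpa [hT.superdiag, ih d (by omega) (l + 1) (by omega)] using h
      · intro i hi hil
        simp only [Finset.mem_range] at hi
        rcases lt_or_gt_of_ne hil with hlt | hgt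
        · rw [hT.above _ _ (by simpa using hlt), mul_zero]
        · rw [ih (N - i) (by omega) i (by omega), zero_mul]
      · intro h
        simp only [Finset.mem_range] at h
        omega

/-! ### Zeros of `B_{N+1}` and signs of the left vectors there. -/

theorem coeff_pos (hα : IsPositiveBidiagonal p T N α) (n k : ℕ) :
    0 < α (k + 1 + n * (p + 1)) := hα.pos _ (by omega)

theorem leftCoeff_pos (hα : IsPositiveBidiagonal p T N α) (n k : ℕ) :
    0 < leftCoeff p α N n k := hα.pos _ (by omega)

theorem rightPoly_wronskian_pos [NeZero p] (hα : IsPositiveBidiagonal p T N α) (n : ℕ) (x : ℝ) :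
    0 < wronskianForm x (rightPoly p α n 0) (rightPoly p α (n + 1) 0) :=
  (isInterlacingForm_wronskianForm x).pos_zero
    (a := fun n k => α (k + 1 + n * (p + 1))) (coeff_pos hα) (NeZero.pos p) n

theorem rightPoly_eval_ne_zero [NeZero p] (hα : IsPositiveBidiagonal p T N α) {n : ℕ} {x : ℝ}
    (hx : (rightPoly p α (n + 1) 0).eval x = 0) : (rightPoly p α n 0).eval x ≠ 0 := by
  intro h
  have := rightPoly_wronskian_pos hα n x
  simp [wronskianForm_apply, hx, h] at this

theorem exists_zeros_rightPoly [NeZero p] (hα : IsPositiveBidiagonal p T N α) (n : ℕ) :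
    ∃ lam : Fin (n + 1) → ℝ, StrictAnti lam ∧
      rightPoly p α (n + 1) 0 = ∏ i, (X - C (lam i)) := by
  obtain ⟨h1, h2⟩ := stepPoly_monic_and_natDegree p (fun n k => α (k + 1 + n * (p + 1))) (n + 1) 0
  refine exists_strictAnti_prod h1 h2 (fun z hz h => ?_) fun x hx h => ?_
  · have : 0 < imForm z (rightPoly p α n 0) (rightPoly p α (n + 1) 0) :=
      (isInterlacingForm_imForm hz).pos_zero
        (a := fun n k => α (k + 1 + n * (p + 1))) (coeff_pos hα) (NeZero.pos p) n
    rw [imForm_apply, h] at this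
    simp at this
  · have := rightPoly_wronskian_pos hα n x
    rw [wronskianForm_apply, hx, h] at this
    simp at this

theorem leftVec_mul_derivative_pos (hα : IsPositiveBidiagonal p T N α) {x : ℝ}
    (hx : (rightPoly p α (N + 1) 0).eval x = 0) {k : ℕ} (hk : k < p) :
    0 < leftVec p α N x k 0 * (derivative (rightPoly p α (N + 1) 0)).eval x := by
  have h := (isInterlacingForm_wronskianForm x).pos_of_pos (leftCoeff_pos hα) N
    (Nat.sub_pos_of_lt hk) (Nat.sub_le p k)
  rw [← rightPoly_eq_stepPoly_left hα, wronskianForm_apply, hx, mul_zero, sub_zero] at h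
  simpa [leftVec] using h

/-- At a zero of `B_{N+1}`, a solution of the left recursion that vanishes at `N + 1, …, N + p - 1`
is a multiple of the left eigenvector of `T^{[N]}`. -/
theorem eq_mul_leftVec [NeZero p] (hT : IsBandedMonicHessenberg p T)
    (hα : IsPositiveBidiagonal p T N α) {x : ℝ} (hx : (rightPoly p α (N + 1) 0).eval x = 0)
    {v : ℕ → ℝ} (hv : ∀ n, ∑ l ∈ Finset.range (n + p + 1), v l * T l n = x * v n)
    (h0 : ∀ i, i + 1 < p → v (N + 1 + i) = 0) {l : ℕ} (hl : l < N + p) :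
    v l = v N * leftVec p α N x 0 l := by
  rcases lt_or_ge N l with hNl | hlN
  · obtain ⟨i, rfl⟩ := Nat.exists_eq_add_of_le (Nat.succ_le_of_lt hNl)
    rw [h0 i (by omega), leftVec, if_neg (by omega), mul_zero]
  -- Column `N` of the recursion involves the unknown `v (N + p)`. Pairing with the right
  -- eigenvector `(B_l(x))` recovers this equation from the other columns, because `B_N(x) ≠ 0`.
  have hlast : ((fun i : Fin (N + 1) => v i) ᵥ* trunc T N) (Fin.last N) = x * v N := by
    have h := dotProduct_mulVec (fun i : Fin (N + 1) => v i) (trunc T N)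
      (fun j => (rightPoly p α j 0).eval x)
    rw [trunc_mulVec_rightPoly hα, hx, Pi.single_zero, sub_zero, dotProduct_smul, dotProduct,
      dotProduct, Fin.sum_univ_castSucc, Fin.sum_univ_castSucc, smul_eq_mul, mul_add,
      Finset.mul_sum] at h
    have e : ∀ i : Fin N, ((fun i : Fin (N + 1) => v i) ᵥ* trunc T N) i.castSucc =
        x * v i := fun i => vecMul_trunc_of_sum_column hT hv h0 (by simp)
    simp only [e, Fin.val_castSucc, Fin.val_last, mul_assoc, add_right_inj] at h
    rw [← mul_assoc] at h
    exact (mul_right_cancel₀ (rightPoly_eval_ne_zero hα hx) h).symm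
  have heig : ∀ j : Fin (N + 1), ((fun i : Fin (N + 1) => v i) ᵥ* trunc T N) j = x * v j := by
    intro j
    induction j using Fin.lastCases with
    | last => exact hlast
    | cast j => exact vecMul_trunc_of_sum_column hT hv h0 (by simp)
  have hw := leftVec_vecMul_trunc hα x
  rw [← rightPoly_eq_stepPoly_left hα, hx, Pi.single_zero, sub_zero] at hw
  have hu := eq_zero_of_vecMul_trunc (N := N) hT (x := x)
    (u := fun l => v l - v N * leftVec p α N x 0 l) (fun j => ?_) ?_ (N - l) l (by omega)
  · exact sub_eq_zero.mp hu
  · have e : (fun i : Fin (N + 1) => v i - v N * leftVec p α N x 0 i) =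
        (fun i : Fin (N + 1) => v i) - v N • fun i : Fin (N + 1) => leftVec p α N x 0 i := rfl
    rw [e, sub_vecMul, smul_vecMul, hw, Pi.sub_apply, heig]
    simp only [Pi.smul_apply, smul_eq_mul]
    ring
  · simp [leftVec, stepPoly]

/-! ### The initial condition matrix `𝓛` paired with the left vectors. -/

/-- The entries of `L_1 ⋯ L_k`, which do not depend on the size of the matrices. -/
def lowerEntry (p : ℕ) (α : ℕ → ℝ) : ℕ → ℕ → ℕ → ℝ
  | 0, i, j => if i = j then 1 else 0
  | k + 1, i, j => lowerEntry p α k i j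
      + lowerEntry p α k i (j + 1) * α (k + 1 + 1 + j * (p + 1))

theorem lowerEntry_of_lt (k : ℕ) : ∀ {i j : ℕ}, i < j → lowerEntry p α k i j = 0 := by
  induction k with
  | zero => intro i j h; simp [lowerEntry, h.ne]
  | succ k ih => intro i j h; simp [lowerEntry, ih h, ih (h.trans (Nat.lt_succ_self j))]

theorem lowerEntry_of_add_lt (k : ℕ) : ∀ {i j : ℕ}, j + k < i → lowerEntry p α k i j = 0 := by
  induction k with
  | zero => intro i j h; simp [lowerEntry, (show i ≠ j by omega)]
  | succ k ih =>
    intro i j h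
    simp [lowerEntry, ih (show j + k < i by omega), ih (show j + 1 + k < i by omega)]

theorem lowerProd_apply (k : ℕ) :
    ∀ i j : Fin (N + 1), lowerProd p α N k i j = lowerEntry p α k i j := by
  induction k with
  | zero => intro i j; simp [lowerProd, lowerEntry, one_apply, Fin.ext_iff]
  | succ k ih =>
    intro i j
    have h : (fun l => lowerProd p α N k i l) = fun l : Fin (N + 1) => lowerEntry p α k i l :=
      funext (ih i)
    refine (congrArg (fun v => (v ᵥ* lowerFactor p α N (k + 1)) j) h).trans ?_
    exact vecMul_lowerFactor _ _ (lowerEntry_of_lt k i.2) j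

/-- Sizes `p` and `N + 1` can be compared in either order: column `0` of `L_1 ⋯ L_k` vanishes below
row `k < p`, and `leftVec` vanishes beyond `N`. -/
theorem sum_leftVec_mul_lowerEntry (x : ℝ) {k : ℕ} (hk : k < p) :
    ∑ l ∈ Finset.range p, leftVec p α N x 0 l * lowerEntry p α k l 0 = leftVec p α N x k 0 := by
  have h := congrFun (leftVec_vecMul_lowerProd (p := p) (α := α) (N := N) x hk.le) 0
  simp only [vecMul, dotProduct, lowerProd_apply] at h
  refine Eq.trans ?_ h
  refine Eq.trans ?_ (Fin.sum_univ_eq_sum_range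
    (fun l => leftVec p α N x 0 l * lowerEntry p α k l 0) (N + 1)).symm
  trans ∑ l ∈ Finset.range (N + 1 + p), leftVec p α N x 0 l * lowerEntry p α k l 0
  · refine Finset.sum_subset (Finset.range_subset_range.mpr (by omega)) fun l _ hl => ?_
    simp only [Finset.mem_range, not_lt] at hl
    rw [lowerEntry_of_add_lt k (by omega), mul_zero]
  · refine (Finset.sum_subset (Finset.range_subset_range.mpr (by omega)) fun l _ hl => ?_).symm
    simp only [Finset.mem_range, not_lt] at hl
    rw [leftVec, if_neg (by omega), zero_mul]

theorem sum_leftVec_mul_scriptL [NeZero p] (x : ℝ) (k : Fin p) :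
    ∑ l : Fin p, leftVec p α N x 0 l * scriptL p α l k =
      leftVec p α N x k 0 / ∏ r ∈ Finset.range k, α (k + 1 + r * p) := by
  simp only [scriptL, of_apply, lowerProd_apply, mul_div_assoc', ← Finset.sum_div]
  congr 1
  exact (Fin.sum_univ_eq_sum_range (fun l => leftVec p α N x 0 l * lowerEntry p α k l 0) p).trans
    (sum_leftVec_mul_lowerEntry x k.2)

/-! ### The Christoffel coefficients. -/

/-- The numerator of the Christoffel coefficient. -/
noncomputable def christoffelNum [NeZero p] (T : Matrix ℕ ℕ ℝ) (ν : Matrix (Fin p) (Fin p) ℝ)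
    (N : ℕ) (x : ℝ) (a : Fin p) : ℝ :=
  (-1) ^ (a : ℕ) *
    (Matrix.of fun i j : Fin (p - 1) => (typeI T ν (skip a j) (N + 1 + i)).eval x).det

theorem Q_eval_eq_det [NeZero p] (ν : Matrix (Fin p) (Fin p) ℝ) (x : ℝ) (l : ℕ) :
    (Q T ν l N).eval x =
      (Matrix.of fun i b : Fin p =>
        (typeI T ν b (if (i : ℕ) = 0 then l else N + i)).eval x).det := by
  rw [Q, ← coe_evalRingHom, RingHom.map_det]
  rfl

theorem skip_eq_succAbove {q : ℕ} (a : Fin (q + 1)) (j : Fin q) :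
    skip a j = a.succAbove j := by
  rw [skip, Fin.succAbove]
  rfl

/-- Laplace expansion along the first row, the only one that depends on `l`; the numerators are its
cofactors. -/
theorem Q_eval_eq_typeIComb [NeZero p] (ν : Matrix (Fin p) (Fin p) ℝ) (x : ℝ) (l : ℕ) :
    (Q T ν l N).eval x = typeIComb T ν (christoffelNum T ν N x) x l := by
  obtain ⟨q, rfl⟩ := Nat.exists_eq_succ_of_ne_zero (NeZero.ne p)
  rw [Q_eval_eq_det]
  refine (det_succ_row_zero _).trans ?_
  rw [typeIComb]
  refine Finset.sum_congr rfl fun a _ => ?_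
  have e : ∀ i : Fin q, N + ((i : ℕ) + 1) = N + 1 + i := fun i => by omega
  have h : (Matrix.of fun i b : Fin (q + 1) =>
        (typeI T ν b (if (i : ℕ) = 0 then l else N + i)).eval x).submatrix Fin.succ a.succAbove =
      Matrix.of fun i j : Fin q => (typeI T ν (skip a j) (N + 1 + i)).eval x := by
    ext i j
    simp [skip_eq_succAbove, e]
  rw [h, christoffelNum]
  simp only [of_apply, Fin.val_zero, if_true]
  exact mul_right_comm _ _ _

theorem Q_eval_eq_zero [NeZero p] (ν : Matrix (Fin p) (Fin p) ℝ) (x : ℝ) {i : ℕ} (hi : i + 1 < p) :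
    (Q T ν (N + 1 + i) N).eval x = 0 := by
  rw [Q_eval_eq_det]
  refine det_zero_of_row_eq (i := ⟨0, by omega⟩) (j := ⟨i + 1, hi⟩) (by simp) ?_
  ext b
  simp [add_assoc, add_comm 1 i]

theorem IsLowerUnitriangular.isUnit_det {ν : Matrix (Fin p) (Fin p) ℝ}
    (hν : IsLowerUnitriangular ν) : IsUnit ν.det := by
  rw [det_of_isLowerTriangular ν fun i j hij => hν.2 i j hij]
  simp [hν.1]

theorem mulVec_eq_typeIComb [NeZero p] (ν : Matrix (Fin p) (Fin p) ℝ) (c : Fin p → ℝ) (x : ℝ) :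
    ν *ᵥ c = fun l : Fin p => typeIComb T ν c x l := by
  ext l
  simp [mulVec, dotProduct, typeIComb, typeI_of_lt, mul_comm]

/-- A kernel vector `c` would give a combination vanishing at `N, …, N + p - 1`, hence at all
smaller indices by `eq_mul_leftVec`. Its initial values are `ν c`, which forces `c = 0`. -/
theorem Q_eval_ne_zero [NeZero p] (hT : IsBandedMonicHessenberg p T)
    (hα : IsPositiveBidiagonal p T N α) {ν : Matrix (Fin p) (Fin p) ℝ}
    (hν : IsLowerUnitriangular ν) {x : ℝ} (hx : (rightPoly p α (N + 1) 0).eval x = 0) :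
    (Q T ν N N).eval x ≠ 0 := by
  rw [Q_eval_eq_det]
  intro h
  obtain ⟨c, hc, hMc⟩ := exists_mulVec_eq_zero_iff.mpr h
  have hv : ∀ i : Fin p, typeIComb T ν c x (N + i) = 0 := by
    intro i
    have h := congrFun hMc i
    have e : (if (i : ℕ) = 0 then N else N + i) = N + i := by split_ifs with h <;> simp [h]
    simp only [mulVec, dotProduct, of_apply, e, Pi.zero_apply] at h
    simpa only [typeIComb, mul_comm] using h
  have hN : typeIComb T ν c x N = 0 := hv ⟨0, NeZero.pos p⟩
  refine hc (mulVec_injective_of_isUnit ((isUnit_iff_isUnit_det ν).mpr hν.isUnit_det) ?_)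
  rw [mulVec_zero, mulVec_eq_typeIComb (T := T) ν c x]
  ext l
  rw [eq_mul_leftVec hT hα hx (sum_typeIComb_mul_column hT ν c x)
    (fun i hi => by simpa [add_assoc, add_comm 1 i] using hv ⟨i + 1, hi⟩)
    (show (l : ℕ) < N + p by omega), hN, zero_mul, Pi.zero_apply]

theorem Q_eval_eq_mul_leftVec [NeZero p] (hT : IsBandedMonicHessenberg p T)
    (hα : IsPositiveBidiagonal p T N α) (ν : Matrix (Fin p) (Fin p) ℝ) {x : ℝ}
    (hx : (rightPoly p α (N + 1) 0).eval x = 0) {l : ℕ} (hl : l < N + p) :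
    (Q T ν l N).eval x = (Q T ν N N).eval x * leftVec p α N x 0 l := by
  rw [Q_eval_eq_typeIComb, Q_eval_eq_typeIComb]
  refine eq_mul_leftVec hT hα hx (sum_typeIComb_mul_column hT ν _ x) (fun i hi => ?_) hl
  rw [← Q_eval_eq_typeIComb, Q_eval_eq_zero ν x hi]

/-- For `l < p` the expansion of `Q_{l,N}` reads `ν` times the vector of numerators, so the
numerators follow by inverting `ν`. -/
theorem christoffelNum_eq [NeZero p] (hT : IsBandedMonicHessenberg p T)
    (hα : IsPositiveBidiagonal p T N α) {ν : Matrix (Fin p) (Fin p) ℝ}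
    (hν : IsLowerUnitriangular ν) {𝒞 : Matrix (Fin p) (Fin p) ℝ}
    (hinit : (ν⁻¹)ᵀ = scriptL p α * 𝒞) {x : ℝ}
    (hx : (rightPoly p α (N + 1) 0).eval x = 0) (a : Fin p) :
    christoffelNum T ν N x a = (Q T ν N N).eval x *
      ∑ k : Fin p, leftVec p α N x k 0 / (∏ r ∈ Finset.range k, α (k + 1 + r * p)) * 𝒞 k a := by
  have hc : christoffelNum T ν N x = ν⁻¹ *ᵥ fun l : Fin p => (Q T ν l N).eval x := by
    simp only [Q_eval_eq_typeIComb]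
    rw [← mulVec_eq_typeIComb, mulVec_mulVec, nonsing_inv_mul _ hν.isUnit_det, one_mulVec]
  have e : ∀ l : Fin p, (Q T ν l N).eval x = (Q T ν N N).eval x * leftVec p α N x 0 l :=
    fun l => Q_eval_eq_mul_leftVec hT hα ν hx (by omega)
  rw [hc, ← vecMul_transpose, hinit, ← vecMul_vecMul]
  simp only [e, ← sum_leftVec_mul_scriptL]
  simp only [vecMul, dotProduct, Finset.mul_sum, Finset.sum_mul, mul_assoc]

/-- The sign of `Q_{N,N}(x)` is irrelevant since it cancels. The remaining sum has nonnegative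
terms, and the term `k = a` is positive because `𝒞` has unit diagonal. -/
theorem christoffel_pos [NeZero p] (hT : IsBandedMonicHessenberg p T)
    (hα : IsPositiveBidiagonal p T N α) {ν : Matrix (Fin p) (Fin p) ℝ}
    (hν : IsLowerUnitriangular ν) {𝒞 : Matrix (Fin p) (Fin p) ℝ}
    (h𝒞 : IsUpperUnitriangular 𝒞) (h𝒞_nonneg : ∀ i j, 0 ≤ 𝒞 i j)
    (hinit : (ν⁻¹)ᵀ = scriptL p α * 𝒞) {x : ℝ}
    (hx : (typeII T (N + 1)).eval x = 0) (a : Fin p) :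
    0 < christoffel T ν N x a := by
  rw [typeII_eq_rightPoly hT hα _ le_rfl] at hx
  set D := (derivative (rightPoly p α (N + 1) 0)).eval x with hD
  have hden : ∑ l ∈ Finset.range (N + 1), (Q T ν l N).eval x * (typeII T l).eval x =
      (Q T ν N N).eval x * D := by
    rw [hD, derivative_rightPoly_eval hα hx, Finset.mul_sum]
    refine Finset.sum_congr rfl fun l hl => ?_
    have hl' := Finset.mem_range.mp hl
    have := NeZero.pos p
    rw [Q_eval_eq_mul_leftVec hT hα ν hx (by omega), typeII_eq_rightPoly hT hα _ hl'.le, mul_assoc]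
  have hnum := christoffelNum_eq hT hα hν hinit hx a
  rw [christoffelNum] at hnum
  rw [christoffel, hnum, hden, mul_div_mul_left _ _ (Q_eval_ne_zero hT hα hν hx)]
  have hpos : ∀ k : Fin p,
      0 < leftVec p α N x k 0 / (∏ r ∈ Finset.range k, α (k + 1 + r * p)) / D := by
    intro k
    have h := leftVec_mul_derivative_pos hα hx k.2
    have hd : 0 < ∏ r ∈ Finset.range k, α (k + 1 + r * p) :=
      Finset.prod_pos fun r _ => hα.pos _ (by omega)
    rw [div_right_comm]
    exact div_pos (div_pos_iff.mpr (mul_pos_iff.mp h)) hd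
  rw [Finset.sum_div]
  refine Finset.sum_pos' (fun k _ => ?_) ⟨a, Finset.mem_univ a, ?_⟩
  · rw [mul_div_right_comm]
    exact mul_nonneg (hpos k).le (h𝒞_nonneg k a)
  · rw [h𝒞.1, mul_one]
    exact hpos a

end BandedHessenberg

theorem mainTheorem2 (p : ℕ) [NeZero p] (N : ℕ) (T : Matrix ℕ ℕ ℝ)
    (hT : BandedHessenberg.IsBandedMonicHessenberg p T)
    (α : ℕ → ℝ) (hα : BandedHessenberg.IsPositiveBidiagonal p T N α)
    (ν : Matrix (Fin p) (Fin p) ℝ) (hν : BandedHessenberg.IsLowerUnitriangular ν)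
    (𝒞 : Matrix (Fin p) (Fin p) ℝ) (h𝒞 : BandedHessenberg.IsUpperUnitriangular 𝒞)
    (h𝒞_nonneg : ∀ i j, 0 ≤ 𝒞 i j)
    (hinit : (ν⁻¹)ᵀ = BandedHessenberg.scriptL p α * 𝒞) :
    ∃ lam : Fin (N + 1) → ℝ, StrictAnti lam ∧
      BandedHessenberg.typeII T (N + 1) = ∏ n, (X - C (lam n)) ∧
      ∀ (n : Fin (N + 1)) (a : Fin p),
        0 < BandedHessenberg.christoffel T ν N (lam n) a := by
  obtain ⟨lam, hlam, hprod⟩ := BandedHessenberg.exists_zeros_rightPoly hα N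
  rw [← BandedHessenberg.typeII_eq_rightPoly hT hα _ le_rfl] at hprod
  refine ⟨lam, hlam, hprod, fun n a =>
    BandedHessenberg.christoffel_pos hT hα hν h𝒞 h𝒞_nonneg hinit ?_ a⟩
  rw [hprod, eval_prod]
  exact Finset.prod_eq_zero (Finset.mem_univ n) (by simp)
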